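/- Let $(X,d)$ be a compact metric space and let $\mu$ be a Borel measure on $X$ that is doubling and positive: there is $C>0$ with $0<\mu(B(x,2r))\le C\,\mu(B(x,r))<\infty$ for all $x\in X$, $r>0$, where $B(x,r)$ denotes the open ball. Let $Q>0$ be an exponent for which there is a constant $C>0$ with $$\frac{\mu(B(x,R))}{\mu(B(x,r))}\le C\Big(\frac Rr\Big)^Q\qquad\text{for all } x\in X,\ 0<r\le R.$$ Let $d_w>2$. For a Borel set $U\subseteq X$, $f\in L^2(X,\mu)$ and $r>0$ put $$E_{d_w/2,U}(f,r)=\int_U\frac1{\mu(B(x,r))}\int_{B(x,r)}\frac{|f(y)-f(x)|^2}{r^{d_w}}\,d\mu(y)\,d\mu(x)\in[0,\infty],$$ and let $KS^{d_w/2,2}(X)$ be the set of $f\in L^2(X,\mu)$ with $\limsup_{r\to0^+}E_{d_w/2,X}(f,r)<\infty$. Assume the following 2-Poincaré inequality: there are constants $C>0$ and $\lambda\ge1$ such that for every $f\in KS^{d_w/2,2}(X)$, $x\in X$ and $R>0$, $$\int_{B(x,R)}|f-f_{B(x,R)}|^2\,d\mu\le C R^{d_w}\liminf_{r\to0^+}E_{d_w/2,B(x,\lambda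 R)}(f,r),$$ where $f_{B(x,R)}=\frac1{\mu(B(x,R))}\int_{B(x,R)}f\,d\mu$. Theorem. Assume $0<Q\le d_w$. Then every sequence $(f_n)_{n\ge1}$ in $KS^{d_w/2,2}(X)$ with $$\sup_{n\ge1}\Big(\|f_n\|_{L^2(X,\mu)}+\liminf_{r\to0^+}E_{d_w/2,X}(f_n,r)\Big)<\infty$$ has a subsequence, with a limit function $g$, both independent of $\alpha$, such that for every $1\le\alpha<\infty$ the subsequence and $g$ lie in $L^\alpha(X,\mu)$ and the subsequence converges to $g$ in $L^\alpha(X,\mu)$. -/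

import Mathlib

open MeasureTheory Metric Filter Topology
open scoped ENNReal NNReal

namespace KorevaarSchoen

/-- Volume doubling: some finite `C` satisfies `0 < μ(B(x,2r)) ≤ C μ(B(x,r)) < ∞`
for all `x` and all `r > 0`. -/
def VolumeDoubling {X : Type*} [MetricSpace X] [MeasurableSpace X] (μ : Measure X) : Prop :=
  ∃ C : ℝ≥0, 0 < C ∧ ∀ (x : X) (r : ℝ), 0 < r →
    0 < μ (ball x (2 * r)) ∧ μ (ball x (2 * r)) ≤ C * μ (ball x r) ∧ C * μ (ball x r) < ∞

/-- `Q` is an admissible exponent in the relative volume bound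
`μ(B(x,R)) / μ(B(x,r)) ≤ C (R/r)^Q` for `0 < r ≤ R`. -/
def VolumeGrowth {X : Type*} [MetricSpace X] [MeasurableSpace X] (μ : Measure X) (Q : ℝ) : Prop :=
  ∃ C : ℝ, 0 < C ∧ ∀ (x : X) (r R : ℝ), 0 < r → r ≤ R →
    μ (ball x R) / μ (ball x r) ≤ ENNReal.ofReal (C * (R / r) ^ Q)

/-- The Korevaar–Schoen energy `E_{d_w/2,U}(f,r)`, with values in `[0,∞]`. Only the outer
integral is restricted to `U`. -/
noncomputable def energy {X : Type*} [MetricSpace X] [MeasurableSpace X] (μ : Measure X)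
    (d_w : ℝ) (U : Set X) (f : X → ℝ) (r : ℝ) : ℝ≥0∞ :=
  ∫⁻ x in U, (μ (ball x r))⁻¹ *
    (∫⁻ y in ball x r, ENNReal.ofReal (|f y - f x| ^ 2 / r ^ d_w) ∂μ) ∂μ

/-- `liminf_{r → 0+} E_{d_w/2,U}(f,r)`. -/
noncomputable def lowerEnergy {X : Type*} [MetricSpace X] [MeasurableSpace X] (μ : Measure X)
    (d_w : ℝ) (U : Set X) (f : X → ℝ) : ℝ≥0∞ :=
  liminf (fun r : ℝ => energy μ d_w U f r) (𝓝[>] 0)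

/-- Membership of (the class of) `f` in the Korevaar–Schoen space `KS^{d_w/2,2}(X)`. -/
def MemKS {X : Type*} [MetricSpace X] [MeasurableSpace X] (μ : Measure X)
    (d_w : ℝ) (f : X → ℝ) : Prop :=
  MemLp f 2 μ ∧ limsup (fun r : ℝ => energy μ d_w Set.univ f r) (𝓝[>] 0) < ∞

/-- The 2-Poincaré inequality with Korevaar–Schoen energies; the constants `C` and `Λ` do not
depend on the ball or on the function. -/
def Poincare {X : Type*} [MetricSpace X] [MeasurableSpace X] (μ : Measure X)
    (d_w : ℝ) : Prop :=
  ∃ C Λ : ℝ, 0 < C ∧ 1 ≤ Λ ∧ ∀ f : X → ℝ, MemKS μ d_w f → ∀ (x : X) (R : ℝ), 0 < R →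
    ∫⁻ y in ball x R, ENNReal.ofReal (|f y - ⨍ z in ball x R, f z ∂μ| ^ 2) ∂μ ≤
      ENNReal.ofReal (C * R ^ d_w) * lowerEnergy μ d_w (ball x (Λ * R)) f

end KorevaarSchoen

/-!
The proof compares a function `f` with the step functions `ballAverages`: on a net of scale
`r = 2⁻ᵏ`, the value of `f` at a point is replaced by its mean over the ball of radius `r` about a
net point nearby.

* In `L²` the error is at most a constant times `r ^ d_w` times the energy of `f`. This is the sum of
  the Poincaré inequalities over the balls of the net: by the volume growth bound the enlarged
  balls overlap boundedly (`exists_sum_indicator_ball_le`), and a lower limit is superadditive, so the local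
  energies add up to at most a multiple of the global one (`sum_lowerEnergy_le`).
* The assumption `Q ≤ d_w` bounds `r ^ d_w` by the volume of a ball of radius `r`, so the Poincaré
  inequality bounds the mean oscillation of `f`. Hence the step functions of consecutive scales
  differ by a uniformly bounded amount (`exists_enorm_setAverage_sub_sq_le`).
* Consecutive step functions therefore differ by a quantity that is bounded uniformly and decays
  geometrically in `L²`, so it decays geometrically in `Lᵖ` for every `p < ∞`
  (`eLpNorm_sub_le_of_geometric`). This telescoping takes the place of the John–Nirenberg inequality:
  it shows that the step functions approximate `f` in every `Lᵖ`, uniformly over functions of bounded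
  energy (`exists_eLpNorm_sub_ballAverages_le`).

The step functions involve countably many means over balls in all, each bounded along the sequence by
its `L²` bound. Along a diagonal subsequence all of them converge, so for each scale the step functions
converge uniformly, and the subsequence is Cauchy in every `Lᵖ`. Its limit in `L¹` is an almost everywhere limit along
a further subsequence, so by Fatou's lemma it is the limit in every `Lᵖ`
(`exists_common_tendsto_eLpNorm`).
-/

namespace KorevaarSchoen

variable {X : Type*} [MetricSpace X] [MeasurableSpace X] {μ : Measure X}

/-! ### Volumes of balls -/

lemma VolumeDoubling.measure_ball_pos (h : VolumeDoubling μ) (x : X) {r : ℝ} (hr : 0 < r) :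
    0 < μ (ball x r) := by
  obtain ⟨C, -, h⟩ := h
  simpa [mul_div_cancel₀] using (h x (r / 2) (half_pos hr)).1

lemma VolumeDoubling.measure_ball_lt_top (h : VolumeDoubling μ) (x : X) {r : ℝ} (hr : 0 < r) :
    μ (ball x r) < ∞ := by
  obtain ⟨C, -, h⟩ := h
  have h' := h x (r / 2) (half_pos hr)
  rw [mul_div_cancel₀ r two_ne_zero] at h'
  exact h'.2.1.trans_lt h'.2.2

lemma VolumeDoubling.measure_univ_lt_top [CompactSpace X] (h : VolumeDoubling μ) :
    μ Set.univ < ∞ := by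
  rcases isEmpty_or_nonempty X with hX | ⟨⟨x⟩⟩
  · simp [Set.univ_eq_empty_iff.2 hX]
  · obtain ⟨r, hr⟩ := (isCompact_univ (X := X)).isBounded.subset_ball x
    exact (measure_mono (hr.trans (ball_subset_ball (le_max_left r 1)))).trans_lt
      (h.measure_ball_lt_top x (lt_max_of_lt_right one_pos))

lemma VolumeGrowth.exists_measure_ball_le (hVD : VolumeDoubling μ) {Q : ℝ}
    (hQ : VolumeGrowth μ Q) : ∃ C : ℝ, 0 < C ∧ ∀ (x : X) (r R : ℝ), 0 < r → r ≤ R →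
      μ (ball x R) ≤ ENNReal.ofReal (C * (R / r) ^ Q) * μ (ball x r) := by
  obtain ⟨C, hC, h⟩ := hQ
  refine ⟨C, hC, fun x r R hr hrR => ?_⟩
  exact (ENNReal.div_le_iff (hVD.measure_ball_pos x hr).ne'
    (hVD.measure_ball_lt_top x hr).ne).1 (h x r R hr hrR)

/-- Balls of radius at most one have volume at least of the order `r ^ s`, for every exponent `s`
above a growth exponent. -/
lemma exists_rpow_le_measure_ball [CompactSpace X] (hVD : VolumeDoubling μ) {Q s : ℝ}
    (hQ : VolumeGrowth μ Q) (hs : Q ≤ s) :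
    ∃ A : ℝ≥0∞, A ≠ ∞ ∧ ∀ (x : X) (r : ℝ), 0 < r → r ≤ 1 →
      ENNReal.ofReal (r ^ s) ≤ A * μ (ball x r) := by
  rcases isEmpty_or_nonempty X with hX | ⟨⟨x₀⟩⟩
  · exact ⟨0, ENNReal.zero_ne_top, fun x => (hX.false x).elim⟩
  obtain ⟨C, hC, h⟩ := hQ.exists_measure_ball_le hVD
  -- `X` is the ball of radius `D` about each of its points, so its volume is a fixed number.
  obtain ⟨R, hR⟩ := (isCompact_univ (X := X)).isBounded.subset_ball_lt 1 x₀
  obtain ⟨D, hD⟩ : ∃ D : ℝ, 1 ≤ D ∧ ∀ x : X, ball x D = Set.univ := by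
    refine ⟨2 * R, by linarith [hR.1], fun x => Set.eq_univ_of_forall fun y => ?_⟩
    have h1 := hR.2 (Set.mem_univ x)
    have h2 := hR.2 (Set.mem_univ y)
    rw [mem_ball] at *
    linarith [dist_triangle_right y x x₀]
  have hD0 : 0 < D := one_pos.trans_le hD.1
  have hU : μ Set.univ ≠ 0 :=
    ((hVD.measure_ball_pos x₀ one_pos).trans_le (measure_mono (Set.subset_univ _))).ne'
  have hU' : μ Set.univ ≠ ∞ := hVD.measure_univ_lt_top.ne
  refine ⟨ENNReal.ofReal (C * D ^ Q) * (μ Set.univ)⁻¹,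
    ENNReal.mul_ne_top ENNReal.ofReal_ne_top (ENNReal.inv_ne_top.2 hU), fun x r hr hr1 => ?_⟩
  have h1 := h x r D hr (hr1.trans hD.1)
  rw [hD.2, Real.div_rpow hD0.le hr.le, ← mul_div_assoc,
    ENNReal.ofReal_div_of_pos (Real.rpow_pos_of_pos hr Q)] at h1
  have hrQ : ENNReal.ofReal (r ^ Q) ≠ 0 := by
    simpa using Real.rpow_pos_of_pos hr Q
  calc ENNReal.ofReal (r ^ s) ≤ ENNReal.ofReal (r ^ Q) :=
        ENNReal.ofReal_le_ofReal (Real.rpow_le_rpow_of_exponent_ge hr hr1 hs)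
    _ = ENNReal.ofReal (r ^ Q) * μ Set.univ * (μ Set.univ)⁻¹ := by
        rw [mul_assoc, ENNReal.mul_inv_cancel hU hU', mul_one]
    _ ≤ ENNReal.ofReal (r ^ Q) * (ENNReal.ofReal (C * D ^ Q) / ENNReal.ofReal (r ^ Q) *
          μ (ball x r)) * (μ Set.univ)⁻¹ := by gcongr
    _ = ENNReal.ofReal (C * D ^ Q) * (μ Set.univ)⁻¹ * μ (ball x r) := by
        rw [← mul_assoc, ENNReal.mul_div_cancel hrQ ENNReal.ofReal_ne_top]
        ring

/-! ### Nets and their overlap -/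

/-- `σ` moves every point by less than `r`, onto a finite set whose points are more than `r / 2`
apart. As a simple function it is a measurable choice of a nearby point in a net. -/
def IsNetProjection (σ : SimpleFunc X X) (r : ℝ) : Prop :=
  (∀ x, dist x (σ x) < r) ∧ ∀ x y, σ x ≠ σ y → r / 2 < dist (σ x) (σ y)

lemma exists_isNetProjection [CompactSpace X] [OpensMeasurableSpace X] {r : ℝ} (hr : 0 < r) :
    ∃ σ : SimpleFunc X X, IsNetProjection σ r := by
  rcases isEmpty_or_nonempty X with hX | hX
  · exact ⟨SimpleFunc.ofIsEmpty, fun x => (hX.false x).elim, fun x => (hX.false x).elim⟩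
  set ε : ℝ≥0 := (r / 4).toNNReal with hεdef
  have hε : (ε : ℝ) = r / 4 := Real.coe_toNNReal _ (by positivity)
  have hε0 : ε ≠ 0 := by simpa [hεdef] using hr
  have hpack : packingNumber (2 * ε) (Set.univ : Set X) ≠ ⊤ := by
    obtain ⟨F, -, hF, hcov⟩ := exists_finite_isCover_of_isCompact hε0 (isCompact_univ (X := X))
    refine ne_top_of_le_ne_top (Set.encard_ne_top_iff.2 hF)
      ((packingNumber_two_mul_le_externalCoveringNumber ε _).trans ?_)
    exact iInf₂_le F hcov
  obtain ⟨C, hCfin, hCsep, hCcov⟩ : ∃ C : Set X, C.Finite ∧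
      IsSeparated ((2 * ε : ℝ≥0) : ℝ≥0∞) C ∧ IsCover (2 * ε) Set.univ C :=
    ⟨maximalSeparatedSet (2 * ε) Set.univ,
      Set.encard_ne_top_iff.1 ((encard_maximalSeparatedSet hpack).trans_ne hpack),
      isSeparated_maximalSeparatedSet, isCover_maximalSeparatedSet hpack⟩
  obtain ⟨e, he⟩ := hCfin.countable.exists_eq_range (hCcov.nonempty Set.univ_nonempty)
  obtain ⟨N, hN⟩ : ∃ N : ℕ, ∀ c ∈ C, ∃ k ≤ N, e k = c := by
    choose! j hj using fun c (hc : c ∈ C) => (he ▸ hc : c ∈ Set.range e)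
    exact ⟨hCfin.toFinset.sup j, fun c hc =>
      ⟨j c, Finset.le_sup (f := j) (hCfin.mem_toFinset.2 hc), hj c hc⟩⟩
  have hmem : ∀ x, SimpleFunc.nearestPt e N x ∈ C := fun x => he ▸ Set.mem_range_self _
  refine ⟨SimpleFunc.nearestPt e N, fun x => ?_, fun x y hxy => ?_⟩
  · obtain ⟨c, hc, hxc⟩ := hCcov (Set.mem_univ x)
    obtain ⟨k, hk, rfl⟩ := hN c hc
    have h1 : edist (SimpleFunc.nearestPt e N x) x ≤ (2 * ε : ℝ≥0) :=
      (SimpleFunc.edist_nearestPt_le e x hk).trans (by rw [edist_comm]; exact hxc)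
    rw [edist_comm, edist_nndist, ENNReal.coe_le_coe, ← NNReal.coe_le_coe, coe_nndist] at h1
    push_cast at h1
    linarith
  · have h1 := hCsep (hmem x) (hmem y) hxy
    beta_reduce at h1
    rw [edist_nndist, ENNReal.coe_lt_coe, ← NNReal.coe_lt_coe, coe_nndist] at h1
    push_cast at h1
    linarith

/-- The points of a net close to a given point are boundedly many, uniformly in the scale. -/
lemma exists_sum_indicator_ball_le [OpensMeasurableSpace X] (hVD : VolumeDoubling μ) {Q : ℝ}
    (hQ : VolumeGrowth μ Q) {Λ : ℝ} (hΛ : 1 ≤ Λ) :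
    ∃ N : ℕ, ∀ (r : ℝ) (σ : SimpleFunc X X), 0 < r → IsNetProjection σ r → ∀ x : X,
      ∑ c ∈ σ.range, (ball c (Λ * r)).indicator (fun _ => (1 : ℝ≥0∞)) x ≤ N := by
  classical
  obtain ⟨C, hC, h⟩ := hQ.exists_measure_ball_le hVD
  set K : ℝ := C * (4 * (2 * Λ + 1)) ^ Q
  obtain ⟨N, hN⟩ := exists_nat_ge K
  refine ⟨N, fun r σ hr hσ x => ?_⟩
  set V := μ (ball x ((Λ + 1) * r))
  have hr' : 0 < (Λ + 1) * r := by positivity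
  have hV0 : V ≠ 0 := (hVD.measure_ball_pos x hr').ne'
  have hVt : V ≠ ∞ := (hVD.measure_ball_lt_top x hr').ne
  set T := σ.range.filter fun c => x ∈ ball c (Λ * r)
  have hsum : ∑ c ∈ σ.range, (ball c (Λ * r)).indicator (fun _ => (1 : ℝ≥0∞)) x = T.card := by
    simp [T, Set.indicator_apply]
  -- The balls of radius `r / 4` about these points are disjoint, lie in the ball of volume `V`,
  -- and each has volume at least `V / K`.
  have hdisj : (T : Set X).PairwiseDisjoint fun c => ball c (r / 4) := by
    intro a ha b hb hab
    obtain ⟨a', rfl⟩ := SimpleFunc.mem_range.1 (Finset.mem_filter.1 ha).1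
    obtain ⟨b', rfl⟩ := SimpleFunc.mem_range.1 (Finset.mem_filter.1 hb).1
    exact ball_disjoint_ball (by linarith [hσ.2 a' b' hab])
  have hsub : ∑ c ∈ T, μ (ball c (r / 4)) ≤ V := by
    rw [← measure_biUnion_finset hdisj fun c _ => measurableSet_ball]
    refine measure_mono (Set.iUnion₂_subset fun c hc => ?_)
    have hxc : dist x c < Λ * r := (Finset.mem_filter.1 hc).2
    refine ball_subset_ball' ?_
    rw [dist_comm]; nlinarith
  have hlow : ∀ c ∈ T, V ≤ ENNReal.ofReal K * μ (ball c (r / 4)) := by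
    intro c hc
    have hxc : dist x c < Λ * r := (Finset.mem_filter.1 hc).2
    have h1 := h c (r / 4) ((2 * Λ + 1) * r) (by positivity) (by nlinarith)
    have h2 : (2 * Λ + 1) * r / (r / 4) = 4 * (2 * Λ + 1) := by field_simp
    rw [h2] at h1
    exact (measure_mono (ball_subset_ball' (by nlinarith))).trans h1
  have hcount : (T.card : ℝ≥0∞) * V ≤ N * V :=
    calc (T.card : ℝ≥0∞) * V = ∑ c ∈ T, V := by simp
      _ ≤ ∑ c ∈ T, ENNReal.ofReal K * μ (ball c (r / 4)) := Finset.sum_le_sum hlow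
      _ ≤ ENNReal.ofReal K * V := by rw [← Finset.mul_sum]; gcongr
      _ ≤ N * V := by
          gcongr
          exact (ENNReal.ofReal_le_ofReal hN).trans_eq (ENNReal.ofReal_natCast N)
  rw [hsum]
  exact (ENNReal.mul_le_mul_iff_left hV0 hVt).1 hcount

/-! ### Superadditivity of the energy -/

lemma liminf_add_liminf_le {ι : Type*} (l : Filter ι) (u v : ι → ℝ≥0∞) :
    liminf u l + liminf v l ≤ liminf (fun i => u i + v i) l := by
  simp only [liminf_eq_iSup_iInf]
  refine ENNReal.biSup_add_biSup_le' (p := fun s => s ∈ l) (q := fun s => s ∈ l)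
    ⟨Set.univ, univ_mem⟩ ⟨Set.univ, univ_mem⟩ fun s hs t ht => ?_
  refine le_iSup₂_of_le (s ∩ t) (inter_mem hs ht) (le_iInf₂ fun i hi => ?_)
  exact add_le_add (iInf₂_le i hi.1) (iInf₂_le i hi.2)

/-- Energies on boundedly overlapping balls add up to at most a multiple of the total energy,
because a lower limit is superadditive. -/
lemma sum_lowerEnergy_le [OpensMeasurableSpace X] {N : ℕ} {S : Finset X} {ρ d_w : ℝ}
    (hS : ∀ x : X, ∑ c ∈ S, (ball c ρ).indicator (fun _ => (1 : ℝ≥0∞)) x ≤ N) (f : X → ℝ) :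
    ∑ c ∈ S, lowerEnergy μ d_w (ball c ρ) f ≤ N * lowerEnergy μ d_w Set.univ f := by
  have hsuper : ∀ S : Finset X, ∑ c ∈ S, lowerEnergy μ d_w (ball c ρ) f ≤
      liminf (fun r => ∑ c ∈ S, energy μ d_w (ball c ρ) f r) (𝓝[>] 0) := by
    classical
    intro S
    induction S using Finset.induction_on with
    | empty => simp
    | insert a S ha ih =>
      simp only [Finset.sum_insert ha]
      exact (add_le_add le_rfl ih).trans (liminf_add_liminf_le _ _ _)
  have hmeas : ∑ c ∈ S, μ.restrict (ball c ρ) ≤ (N : ℝ≥0∞) • μ := by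
    refine Measure.le_iff.2 fun s hs => ?_
    calc (∑ c ∈ S, μ.restrict (ball c ρ)) s
        = ∫⁻ x in s, ∑ c ∈ S, (ball c ρ).indicator (fun _ => (1 : ℝ≥0∞)) x ∂μ := by
          rw [lintegral_finsetSum _ fun c _ => measurable_const.indicator measurableSet_ball]
          simp [Measure.restrict_apply, hs, measurableSet_ball, Set.inter_comm]
      _ ≤ ∫⁻ x in s, (N : ℝ≥0∞) ∂μ := lintegral_mono hS
      _ = ((N : ℝ≥0∞) • μ) s := by simp
  have henergy : ∀ r, ∑ c ∈ S, energy μ d_w (ball c ρ) f r ≤ N * energy μ d_w Set.univ f r := by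
    intro r
    unfold energy
    rw [← lintegral_finsetSum_measure, Measure.restrict_univ]
    refine (lintegral_mono' hmeas le_rfl).trans_eq ?_
    rw [lintegral_smul_measure, smul_eq_mul]
  refine (hsuper S).trans ((liminf_le_liminf (Eventually.of_forall henergy)).trans_eq ?_)
  exact ENNReal.liminf_const_mul_of_ne_top (ENNReal.natCast_ne_top N)

/-! ### Averages over balls -/

lemma enorm_sq_eq_ofReal (a : ℝ) : ‖a‖ₑ ^ 2 = ENNReal.ofReal (|a| ^ 2) := by
  rw [ENNReal.ofReal_pow (abs_nonneg a), Real.enorm_eq_ofReal_abs]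

omit [MetricSpace X] in
/-- Jensen's inequality for the mean of a square-integrable function over a set. -/
lemma enorm_setAverage_sub_sq_mul_le {f : X → ℝ} (hf : MemLp f 2 μ) {B : Set X}
    (hB : μ B ≠ 0) (hB' : μ B ≠ ∞) (a : ℝ) :
    ‖(⨍ z in B, f z ∂μ) - a‖ₑ ^ 2 * μ B ≤ ∫⁻ z in B, ‖f z - a‖ₑ ^ 2 ∂μ := by
  have : IsFiniteMeasure (μ.restrict B) := ⟨by simpa using hB'.lt_top⟩
  have hfB : MemLp f 2 (μ.restrict B) := hf.restrict B
  have hg : MemLp (fun z => f z - a) 2 (μ.restrict B) := hfB.sub (memLp_const a)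
  have hgi : Integrable (fun z => f z - a) (μ.restrict B) := hg.integrable one_le_two
  have hg2 : Integrable (fun z => (f z - a) ^ 2) (μ.restrict B) := hg.integrable_sq
  have hav : (⨍ z in B, f z ∂μ) - a = ⨍ z in B, (f z - a) ∂μ := by
    have hm : μ.real B ≠ 0 := ENNReal.toReal_ne_zero.2 ⟨hB, hB'⟩
    rw [setAverage_eq, setAverage_eq, integral_sub (hfB.integrable one_le_two)
      (integrable_const a)]
    simp [mul_sub, hm]
  have hJ : (⨍ z in B, (f z - a) ∂μ) ^ 2 ≤ ⨍ z in B, (f z - a) ^ 2 ∂μ :=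
    (even_two.convexOn_pow (𝕜 := ℝ)).map_set_average_le (continuous_pow 2).continuousOn
      isClosed_univ hB hB' (by simp) hgi hg2
  have hm : 0 < μ.real B := ENNReal.toReal_pos hB hB'
  rw [hav, enorm_sq_eq_ofReal, sq_abs]
  simp_rw [enorm_sq_eq_ofReal, sq_abs]
  rw [← ofReal_integral_eq_lintegral_ofReal hg2 (ae_of_all _ fun z => sq_nonneg _),
    ← ENNReal.ofReal_toReal hB', ← ENNReal.ofReal_mul (sq_nonneg _)]
  refine ENNReal.ofReal_le_ofReal ?_
  rw [setAverage_eq μ (fun z => (f z - a) ^ 2), smul_eq_mul, ← div_eq_inv_mul, le_div_iff₀ hm] at hJ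
  exact hJ

/-- The step function that replaces `f` at `x` by its mean over the ball of radius `r` about
`σ x`. -/
noncomputable def ballAverages (μ : Measure X) (σ : SimpleFunc X X) (r : ℝ) (f : X → ℝ) :
    SimpleFunc X ℝ :=
  σ.map fun c => ⨍ z in ball c r, f z ∂μ

/-- The local Poincaré inequalities on the balls of a net add up to a global one. -/
lemma exists_lintegral_sub_ballAverages_sq_le [OpensMeasurableSpace X] (hVD : VolumeDoubling μ)
    {d_w Q : ℝ} (hP : Poincare μ d_w) (hQ : VolumeGrowth μ Q) :
    ∃ D : ℝ≥0∞, D ≠ ∞ ∧ ∀ (r : ℝ) (σ : SimpleFunc X X), 0 < r → IsNetProjection σ r →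
      ∀ f : X → ℝ, MemKS μ d_w f → ∫⁻ x, ‖f x - ballAverages μ σ r f x‖ₑ ^ 2 ∂μ ≤
        D * ENNReal.ofReal (r ^ d_w) * lowerEnergy μ d_w Set.univ f := by
  obtain ⟨C, Λ, hC, hΛ, hP⟩ := hP
  obtain ⟨N, hN⟩ := exists_sum_indicator_ball_le hVD hQ hΛ
  refine ⟨ENNReal.ofReal C * N, ENNReal.mul_ne_top ENNReal.ofReal_ne_top
    (ENNReal.natCast_ne_top N), fun r σ hr hσ f hf => ?_⟩
  set h : X → X → ℝ≥0∞ := fun c x => ‖f x - ⨍ z in ball c r, f z ∂μ‖ₑ ^ 2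
  have hmeas : ∀ c, AEMeasurable (h c) μ := fun c =>
    ((hf.1.aestronglyMeasurable.sub aestronglyMeasurable_const).enorm).pow_const 2
  calc ∫⁻ x, ‖f x - ballAverages μ σ r f x‖ₑ ^ 2 ∂μ
      ≤ ∫⁻ x, ∑ c ∈ σ.range, (ball c r).indicator (h c) x ∂μ := by
        refine lintegral_mono fun x => ?_
        refine le_trans (le_of_eq ?_) (Finset.single_le_sum
          (f := fun c => (ball c r).indicator (h c) x) (fun _ _ => zero_le)
          (SimpleFunc.mem_range_self σ x))
        rw [Set.indicator_of_mem (mem_ball.2 (hσ.1 x))]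
        rfl
    _ = ∑ c ∈ σ.range, ∫⁻ x in ball c r, h c x ∂μ := by
        rw [lintegral_finsetSum' _ fun c _ => (hmeas c).indicator measurableSet_ball]
        simp_rw [lintegral_indicator measurableSet_ball]
    _ ≤ ∑ c ∈ σ.range, ENNReal.ofReal (C * r ^ d_w) * lowerEnergy μ d_w (ball c (Λ * r)) f := by
        refine Finset.sum_le_sum fun c _ => ?_
        simp_rw [h, enorm_sq_eq_ofReal]
        exact hP f hf c r hr
    _ ≤ ENNReal.ofReal (C * r ^ d_w) * (N * lowerEnergy μ d_w Set.univ f) := by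
        rw [← Finset.mul_sum]
        gcongr
        exact sum_lowerEnergy_le (hN r σ hr hσ) f
    _ = _ := by rw [ENNReal.ofReal_mul hC.le]; ring

/-- The mean oscillation of `f` is controlled by its energy alone: since `Q ≤ d_w`, the factor
`r ^ d_w` of the Poincaré inequality is at most a multiple of the volume of a ball of radius `r`,
so means over neighbouring balls of comparable radii differ by a bounded amount. -/
lemma exists_enorm_setAverage_sub_sq_le [CompactSpace X] (hVD : VolumeDoubling μ)
    {d_w Q : ℝ} (hP : Poincare μ d_w) (hQ : VolumeGrowth μ Q) (hQ_pos : 0 < Q)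
    (hQ_le : Q ≤ d_w) :
    ∃ K : ℝ≥0∞, K ≠ ∞ ∧ ∀ f : X → ℝ, MemKS μ d_w f → ∀ (r : ℝ) (c c' : X), 0 < r → r ≤ 1 →
      dist c' c < 3 / 2 * r →
      ‖(⨍ z in ball c' (r / 2), f z ∂μ) - ⨍ z in ball c r, f z ∂μ‖ₑ ^ 2 ≤
        K * lowerEnergy μ d_w Set.univ f := by
  obtain ⟨C, Λ, hC, -, hP⟩ := hP
  obtain ⟨A, hA, hvol⟩ := exists_rpow_le_measure_ball hVD hQ hQ_le
  set K : ℝ≥0∞ := ENNReal.ofReal (C * 4 ^ d_w) * A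
  have hd : 0 ≤ d_w := hQ_pos.le.trans hQ_le
  refine ⟨2 ^ 2 * K, by finiteness, fun f hf r c c' hr hr1 hcc => ?_⟩
  set L := lowerEnergy μ d_w Set.univ f
  set a := ⨍ z in ball c (2 * r), f z ∂μ
  -- Both balls are compared with the ball of radius `2 * r` about `c`, which contains them.
  have key : ∀ (b : X) (ρ : ℝ), r / 2 ≤ ρ → ρ ≤ 1 → ball b ρ ⊆ ball c (2 * r) →
      ‖(⨍ z in ball b ρ, f z ∂μ) - a‖ₑ ^ 2 ≤ K * L := by
    intro b ρ hρ hρ1 hsub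
    have hρ0 : 0 < ρ := (half_pos hr).trans_le hρ
    have h0 := (hVD.measure_ball_pos b hρ0).ne'
    have ht := (hVD.measure_ball_lt_top b hρ0).ne
    refine (ENNReal.mul_le_mul_iff_left h0 ht).1 ?_
    calc ‖(⨍ z in ball b ρ, f z ∂μ) - a‖ₑ ^ 2 * μ (ball b ρ)
        ≤ ∫⁻ z in ball b ρ, ‖f z - a‖ₑ ^ 2 ∂μ := enorm_setAverage_sub_sq_mul_le hf.1 h0 ht a
      _ ≤ ∫⁻ z in ball c (2 * r), ‖f z - a‖ₑ ^ 2 ∂μ := lintegral_mono_set hsub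
      _ ≤ ENNReal.ofReal (C * (2 * r) ^ d_w) * lowerEnergy μ d_w (ball c (Λ * (2 * r))) f := by
          simp_rw [enorm_sq_eq_ofReal]
          exact hP f hf c (2 * r) (by positivity)
      _ ≤ ENNReal.ofReal (C * 4 ^ d_w) * ENNReal.ofReal (ρ ^ d_w) * L := by
          rw [← ENNReal.ofReal_mul (by positivity), mul_assoc,
            ← Real.mul_rpow (by norm_num) hρ0.le]
          refine mul_le_mul' (ENNReal.ofReal_le_ofReal ?_) (liminf_le_liminf
            (Eventually.of_forall fun s => lintegral_mono_set (Set.subset_univ _)))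
          exact mul_le_mul_of_nonneg_left
            (Real.rpow_le_rpow (by positivity) (by linarith) hd) hC.le
      _ ≤ ENNReal.ofReal (C * 4 ^ d_w) * (A * μ (ball b ρ)) * L := by
          gcongr
          exact hvol b ρ hρ0 hρ1
      _ = K * L * μ (ball b ρ) := by simp only [K]; ring
  have h1 := key c' (r / 2) le_rfl (by linarith) (ball_subset_ball' (by linarith))
  have h2 := key c r (by linarith) hr1 (ball_subset_ball (by linarith))
  set u := ⨍ z in ball c' (r / 2), f z ∂μ
  set v := ⨍ z in ball c r, f z ∂μ
  have htri : ‖u - v‖ₑ ≤ 2 * max ‖u - a‖ₑ ‖v - a‖ₑ := by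
    rw [← sub_sub_sub_cancel_right u v a, two_mul]
    exact enorm_sub_le.trans (add_le_add (le_max_left _ _) (le_max_right _ _))
  calc ‖u - v‖ₑ ^ 2 ≤ (2 * max ‖u - a‖ₑ ‖v - a‖ₑ) ^ 2 := by gcongr
    _ ≤ 2 ^ 2 * (K * L) := by
        rw [mul_pow]
        gcongr
        rcases max_choice ‖u - a‖ₑ ‖v - a‖ₑ with h | h <;> rw [h] <;> assumption
    _ = 2 ^ 2 * K * L := by ring

/-! ### Approximation in `Lᵖ` -/

omit [MetricSpace X] in
lemma eLpNorm_two_le_iff_lintegral_enorm_sq_le {f : X → ℝ} {S : ℝ≥0∞} :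
    eLpNorm f 2 μ ≤ S ↔ ∫⁻ x, ‖f x‖ₑ ^ 2 ∂μ ≤ S ^ 2 := by
  have h := eLpNorm_nnreal_pow_eq_lintegral (f := f) (μ := μ) (p := 2) two_ne_zero
  norm_num at h
  rw [← h]
  exact (ENNReal.pow_le_pow_left_iff two_ne_zero).symm

omit [MetricSpace X] in
/-- Interpolation between `L²` and a uniform bound, for even exponents. -/
lemma eLpNorm_le_of_enorm_sq_le {h : X → ℝ} {S I : ℝ≥0∞} (hS' : S ≠ ∞) (hS : ∀ x, ‖h x‖ₑ ^ 2 ≤ S)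
    (hI : ∫⁻ x, ‖h x‖ₑ ^ 2 ∂μ ≤ I) (m : ℕ) :
    eLpNorm h ((2 * (m + 1) : ℕ) : ℝ≥0∞) μ ≤ (S ^ m * I) ^ (1 / ((2 * (m + 1) : ℕ) : ℝ)) := by
  have hp : ((2 * (m + 1) : ℕ) : ℝ≥0∞) ≠ 0 := by simp
  rw [eLpNorm_eq_lintegral_rpow_enorm_toReal hp (ENNReal.natCast_ne_top _),
    ENNReal.toReal_natCast]
  refine ENNReal.rpow_le_rpow ?_ (by positivity)
  calc ∫⁻ x, ‖h x‖ₑ ^ ((2 * (m + 1) : ℕ) : ℝ) ∂μ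
      ≤ ∫⁻ x, S ^ m * ‖h x‖ₑ ^ 2 ∂μ := by
        refine lintegral_mono fun x => ?_
        rw [ENNReal.rpow_natCast, pow_mul, pow_succ]
        gcongr
        exact hS x
    _ ≤ S ^ m * I := by
        rw [lintegral_const_mul' _ _ (ENNReal.pow_ne_top hS')]
        gcongr

omit [MetricSpace X] in
/-- If `T k` approximates `f` in `L²` at a geometric rate and its increments are uniformly bounded,
then it approximates `f` at a geometric rate in every `Lᵖ` with an even exponent `p`: the increments
decay geometrically in `L²`, hence by interpolation in `Lᵖ`, and they sum to `f - T k`. -/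
lemma eLpNorm_sub_le_of_geometric {f : X → ℝ} {T : ℕ → X → ℝ} (hf : AEStronglyMeasurable f μ)
    (hT : ∀ k, AEStronglyMeasurable (T k) μ) {a S I : ℝ≥0∞} (ha : a < 1) (hS : S ≠ ∞) (hI : I ≠ ∞)
    (hL2 : ∀ k, ∫⁻ x, ‖(f - T k) x‖ₑ ^ 2 ∂μ ≤ I * a ^ k)
    (hosc : ∀ k x, ‖(T (k + 1) - T k) x‖ₑ ^ 2 ≤ S) (m k : ℕ) :
    eLpNorm (f - T k) ((2 * (m + 1) : ℕ) : ℝ≥0∞) μ ≤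
      (S ^ m * (2 ^ 2 * I)) ^ (1 / ((2 * (m + 1) : ℕ) : ℝ)) *
        (1 - a ^ (1 / ((2 * (m + 1) : ℕ) : ℝ)))⁻¹ *
          (a ^ (1 / ((2 * (m + 1) : ℕ) : ℝ))) ^ k := by
  set p : ℝ≥0∞ := ((2 * (m + 1) : ℕ) : ℝ≥0∞) with hp
  have hp1 : 1 ≤ p := Nat.one_le_cast.2 (by omega)
  set q : ℝ := 1 / ((2 * (m + 1) : ℕ) : ℝ)
  have hq : 0 ≤ q := by positivity
  set B : ℝ≥0∞ := (S ^ m * (2 ^ 2 * I)) ^ q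
  set b : ℝ≥0∞ := a ^ q
  have hsq : ∀ y : ℝ≥0∞, (y ^ (1 / 2 : ℝ)) ^ 2 = y := fun y => by
    rw [← ENNReal.rpow_mul_natCast]
    norm_num
  have hfT : ∀ k, eLpNorm (f - T k) 2 μ ≤ (I * a ^ k) ^ (1 / 2 : ℝ) := fun k => by
    rw [eLpNorm_two_le_iff_lintegral_enorm_sq_le, hsq]
    exact hL2 k
  have hinc2 : ∀ k, ∫⁻ x, ‖(T (k + 1) - T k) x‖ₑ ^ 2 ∂μ ≤ 2 ^ 2 * I * a ^ k := fun k => by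
    have h : eLpNorm (T (k + 1) - T k) 2 μ ≤ 2 * (I * a ^ k) ^ (1 / 2 : ℝ) :=
      calc eLpNorm (T (k + 1) - T k) 2 μ = eLpNorm ((f - T k) - (f - T (k + 1))) 2 μ := by
            rw [sub_sub_sub_cancel_left]
        _ ≤ eLpNorm (f - T k) 2 μ + eLpNorm (f - T (k + 1)) 2 μ :=
            eLpNorm_sub_le (hf.sub (hT k)) (hf.sub (hT (k + 1))) one_le_two
        _ ≤ (I * a ^ k) ^ (1 / 2 : ℝ) + (I * a ^ k) ^ (1 / 2 : ℝ) := by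
            refine add_le_add (hfT k) ((hfT (k + 1)).trans ?_)
            exact ENNReal.rpow_le_rpow
              (mul_le_mul_right (pow_le_pow_right_of_le_one' ha.le k.le_succ) I) (by norm_num)
        _ = _ := (two_mul _).symm
    refine (eLpNorm_two_le_iff_lintegral_enorm_sq_le.1 h).trans_eq ?_
    rw [mul_pow, hsq, mul_assoc]
  have hinc : ∀ k, eLpNorm (T (k + 1) - T k) p μ ≤ B * b ^ k := fun k => by
    refine (eLpNorm_le_of_enorm_sq_le hS (hosc k) (hinc2 k) m).trans_eq ?_
    rw [← mul_assoc, ENNReal.mul_rpow_of_nonneg _ _ hq]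
    simp only [B, b]
    rw [← ENNReal.rpow_mul_natCast, ← ENNReal.rpow_natCast_mul, mul_comm q]
  have hsum : ∀ n, eLpNorm (T (k + n) - T k) p μ ≤ ∑ i ∈ Finset.range n, B * b ^ (k + i) := by
    intro n
    induction n with
    | zero => simp
    | succ n ih =>
      rw [Finset.sum_range_succ, ← add_assoc,
        ← sub_add_sub_cancel' (T (k + n)) (T k) (T (k + n + 1))]
      exact (eLpNorm_add_le ((hT _).sub (hT _)) ((hT _).sub (hT _)) hp1).trans
        (add_le_add ih (hinc _))
  have htail : ∀ n, k ≤ n → eLpNorm (T n - T k) p μ ≤ B * (1 - b)⁻¹ * b ^ k := fun n hn => by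
    obtain ⟨n, rfl⟩ := Nat.exists_eq_add_of_le hn
    refine (hsum n).trans ((ENNReal.sum_le_tsum _).trans_eq ?_)
    simp_rw [pow_add, ← mul_assoc]
    rw [ENNReal.tsum_mul_left, ENNReal.tsum_geometric]
    ring
  -- A subsequence of `T` converges to `f` almost everywhere, so the bound passes to the limit.
  have hlim : Tendsto (fun k => eLpNorm (T k - f) 2 μ) atTop (𝓝 0) := by
    have h0 : Tendsto (fun k => I * a ^ k) atTop (𝓝 0) := by
      simpa using ENNReal.Tendsto.const_mul
        (ENNReal.tendsto_pow_atTop_nhds_zero_of_lt_one ha) (Or.inr hI)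
    have h1 : Tendsto (fun k => (I * a ^ k) ^ (1 / 2 : ℝ)) atTop (𝓝 0) := by
      have := h0.ennrpow_const (1 / 2)
      rwa [ENNReal.zero_rpow_of_pos (by norm_num)] at this
    refine tendsto_of_tendsto_of_tendsto_of_le_of_le tendsto_const_nhds h1 (fun _ => zero_le)
      fun k => ?_
    beta_reduce
    rw [eLpNorm_sub_comm]
    exact hfT k
  obtain ⟨ns, hns, hae⟩ :=
    (tendstoInMeasure_of_tendsto_eLpNorm two_ne_zero hT hf hlim).exists_seq_tendsto_ae
  refine Lp.eLpNorm_le_of_ae_tendsto (u := atTop) (f := fun n => T (ns n) - T k)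
    ((hns.tendsto_atTop.eventually_ge_atTop k).mono fun n hn => htail _ hn)
    (fun n => (hT _).sub (hT _)) ?_
  filter_upwards [hae] with x hx
  exact hx.sub tendsto_const_nhds

/-- Averaging over dyadically shrinking balls approximates the functions of bounded energy in
every `Lᵖ` with `p < ∞`, at a rate depending on the energy bound only. -/
lemma exists_eLpNorm_sub_ballAverages_le [CompactSpace X] [OpensMeasurableSpace X]
    (hVD : VolumeDoubling μ) {d_w Q : ℝ} (hP : Poincare μ d_w) (hQ : VolumeGrowth μ Q)
    (hQ_pos : 0 < Q) (hQ_le : Q ≤ d_w) {σ : ℕ → SimpleFunc X X}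
    (hσ : ∀ k, IsNetProjection (σ k) ((1 / 2) ^ k)) {M : ℝ≥0∞} (hM : M ≠ ∞)
    {p : ℝ≥0∞} (hp1 : 1 ≤ p) (hp : p ≠ ∞) :
    ∃ ε : ℕ → ℝ≥0∞, Tendsto ε atTop (𝓝 0) ∧ ∀ f : X → ℝ, MemKS μ d_w f →
      lowerEnergy μ d_w Set.univ f ≤ M → ∀ k,
      eLpNorm (f - ⇑(ballAverages μ (σ k) ((1 / 2) ^ k) f)) p μ ≤ ε k := by
  obtain ⟨D, hD, hL2⟩ := exists_lintegral_sub_ballAverages_sq_le hVD hP hQ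
  obtain ⟨K, hK, hosc⟩ := exists_enorm_setAverage_sub_sq_le hVD hP hQ hQ_pos hQ_le
  obtain ⟨a, ha1, hapow⟩ : ∃ a : ℝ≥0∞, a < 1 ∧
      ∀ k : ℕ, ENNReal.ofReal (((1 / 2 : ℝ) ^ k) ^ d_w) = a ^ k := by
    refine ⟨ENNReal.ofReal ((1 / 2) ^ d_w), ENNReal.ofReal_lt_one.2
      (Real.rpow_lt_one (by norm_num) (by norm_num) (hQ_pos.trans_le hQ_le)), fun k => ?_⟩
    rw [← ENNReal.ofReal_pow (by positivity), ← Real.rpow_natCast_mul (by norm_num), mul_comm,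
      Real.rpow_mul_natCast (by norm_num)]
  obtain ⟨m, hm⟩ : ∃ m : ℕ, p ≤ ((2 * (m + 1) : ℕ) : ℝ≥0∞) := by
    obtain ⟨m, hm⟩ := ENNReal.exists_nat_gt hp
    exact ⟨m, hm.le.trans (Nat.cast_le.2 (by omega))⟩
  set q : ℝ := 1 / ((2 * (m + 1) : ℕ) : ℝ)
  have hq : 0 < q := by positivity
  have hb1 : a ^ q < 1 := ENNReal.rpow_lt_one ha1 hq
  have hKM : K * M ≠ ∞ := ENNReal.mul_ne_top hK hM
  have hDM : D * M ≠ ∞ := ENNReal.mul_ne_top hD hM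
  have hB : ((K * M) ^ m * (2 ^ 2 * (D * M))) ^ q ≠ ∞ :=
    ENNReal.rpow_ne_top_of_nonneg hq.le (ENNReal.mul_ne_top (ENNReal.pow_ne_top hKM)
      (ENNReal.mul_ne_top (by simp) hDM))
  set c : ℝ≥0∞ := μ Set.univ ^ (1 / p.toReal - 1 / ((2 * (m + 1) : ℕ) : ℝ≥0∞).toReal)
  have hc : c ≠ ∞ := by
    refine ENNReal.rpow_ne_top_of_nonneg (sub_nonneg.2 ?_) hVD.measure_univ_lt_top.ne
    exact one_div_le_one_div_of_le (ENNReal.toReal_pos (one_pos.trans_le hp1).ne' hp)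
      (ENNReal.toReal_mono (ENNReal.natCast_ne_top _) hm)
  have hgeom : (1 - a ^ q)⁻¹ ≠ ∞ := ENNReal.inv_ne_top.2 (tsub_pos_of_lt hb1).ne'
  refine ⟨fun k => ((K * M) ^ m * (2 ^ 2 * (D * M))) ^ q * (1 - a ^ q)⁻¹ * c * (a ^ q) ^ k,
    ?_, fun f hf hfM k => ?_⟩
  · simpa using ENNReal.Tendsto.const_mul (ENNReal.tendsto_pow_atTop_nhds_zero_of_lt_one hb1)
      (Or.inr (ENNReal.mul_ne_top (ENNReal.mul_ne_top hB hgeom) hc))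
  set T : ℕ → X → ℝ := fun k => ballAverages μ (σ k) ((1 / 2) ^ k) f
  have hT : ∀ k, AEStronglyMeasurable (T k) μ := fun k =>
    (SimpleFunc.stronglyMeasurable _).aestronglyMeasurable
  have hfm : AEStronglyMeasurable f μ := hf.1.aestronglyMeasurable
  have hfT : ∀ k, ∫⁻ x, ‖(f - T k) x‖ₑ ^ 2 ∂μ ≤ D * M * a ^ k := fun k => by
    refine (hL2 _ (σ k) (by positivity) (hσ k) f hf).trans ?_
    rw [hapow, mul_right_comm]
    gcongr
  have hinc : ∀ k x, ‖(T (k + 1) - T k) x‖ₑ ^ 2 ≤ K * M := fun k x => by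
    have h := hosc f hf ((1 / 2) ^ k) (σ k x) (σ (k + 1) x) (by positivity)
      (pow_le_one₀ (by norm_num) (by norm_num)) (by
        have h1 := (hσ k).1 x
        have h2 := (hσ (k + 1)).1 x
        rw [pow_succ] at h2
        linarith [dist_triangle_left (σ (k + 1) x) (σ k x) x])
    rw [show (1 / 2 : ℝ) ^ k / 2 = (1 / 2) ^ (k + 1) by ring] at h
    exact h.trans (by gcongr)
  refine (eLpNorm_le_eLpNorm_mul_rpow_measure_univ hm (hfm.sub (hT k))).trans ?_
  beta_reduce
  rw [mul_right_comm _ c]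
  exact mul_le_mul_left (eLpNorm_sub_le_of_geometric hfm hT ha1 hKM hDM hfT hinc m k) c

/-! ### Extraction of a convergent subsequence -/

omit [MetricSpace X] in
/-- A sequence that is eventually close to a fixed function, to any precision and in every `Lᵖ` with
`p < ∞`, converges in all these spaces to one and the same function. -/
lemma exists_common_tendsto_eLpNorm {u : ℕ → X → ℝ}
    (hu : ∀ p : ℝ≥0∞, 1 ≤ p → p ≠ ∞ → ∀ n, MemLp (u n) p μ)
    (h : ∀ p : ℝ≥0∞, 1 ≤ p → p ≠ ∞ → ∀ ε : ℝ≥0∞, 0 < ε →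
      ∃ v : X → ℝ, AEStronglyMeasurable v μ ∧ ∀ᶠ n in atTop, eLpNorm (u n - v) p μ ≤ ε) :
    ∃ g : X → ℝ, ∀ p : ℝ≥0∞, 1 ≤ p → p ≠ ∞ →
      MemLp g p μ ∧ Tendsto (fun n => eLpNorm (u n - g) p μ) atTop (𝓝 0) := by
  have hcauchy : ∀ p : ℝ≥0∞, 1 ≤ p → p ≠ ∞ → ∀ ε : ℝ≥0∞, 0 < ε →
      ∃ N, ∀ n ≥ N, ∀ k ≥ N, eLpNorm (u n - u k) p μ ≤ ε := by
    intro p hp1 hp ε hε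
    obtain ⟨v, hv, hvu⟩ := h p hp1 hp (ε / 2) (ENNReal.half_pos hε.ne')
    obtain ⟨N, hN⟩ := eventually_atTop.1 hvu
    refine ⟨N, fun n hn k hk => ?_⟩
    have hm : ∀ n, AEStronglyMeasurable (u n - v) μ := fun n => (hu p hp1 hp n).1.sub hv
    rw [← sub_sub_sub_cancel_right (u n) (u k) v]
    refine (eLpNorm_sub_le (hm n) (hm k) hp1).trans ?_
    exact (add_le_add (hN n hn) (hN k hk)).trans_eq (ENNReal.add_halves ε)
  have hL1 := hu 1 le_rfl ENNReal.one_ne_top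
  obtain ⟨G, hG⟩ : ∃ G : Lp ℝ 1 μ, Tendsto (fun n => (hL1 n).toLp (u n)) atTop (𝓝 G) := by
    refine cauchySeq_tendsto_of_complete (EMetric.cauchySeq_iff.2 fun ε hε => ?_)
    obtain ⟨δ, hδ, hδε⟩ := exists_between hε
    obtain ⟨N, hN⟩ := hcauchy 1 le_rfl ENNReal.one_ne_top δ hδ
    refine ⟨N, fun n hn k hk => ?_⟩
    rw [Lp.edist_toLp_toLp]
    exact (hN n hn k hk).trans_lt hδε
  have hGm : AEStronglyMeasurable G μ := (Lp.memLp G).1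
  obtain ⟨ns, hns, hae⟩ : ∃ ns : ℕ → ℕ, StrictMono ns ∧
      ∀ᵐ x ∂μ, Tendsto (fun i => u (ns i) x) atTop (𝓝 (G x)) := by
    rw [← Lp.toLp_coeFn G (Lp.memLp G), Lp.tendsto_Lp_iff_tendsto_eLpNorm''] at hG
    exact (tendstoInMeasure_of_tendsto_eLpNorm one_ne_zero (fun n => (hL1 n).1) hGm
      hG).exists_seq_tendsto_ae
  refine ⟨G, fun p hp1 hp => ?_⟩
  have hclose : ∀ ε : ℝ≥0∞, 0 < ε → ∃ N, ∀ n ≥ N, eLpNorm (u n - ⇑G) p μ ≤ ε := by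
    intro ε hε
    obtain ⟨N, hN⟩ := hcauchy p hp1 hp ε hε
    refine ⟨N, fun n hn => Lp.eLpNorm_le_of_ae_tendsto (u := atTop)
      (f := fun i => u n - u (ns i)) ((hns.tendsto_atTop.eventually_ge_atTop N).mono fun i hi =>
        hN n hn _ hi) (fun i => (hu p hp1 hp n).1.sub (hu p hp1 hp _).1) ?_⟩
    filter_upwards [hae] with x hx
    exact tendsto_const_nhds.sub hx
  refine ⟨?_, ENNReal.tendsto_atTop_zero.2 hclose⟩
  obtain ⟨N, hN⟩ := hclose 1 one_pos
  have hdiff : MemLp (u N - ⇑G) p μ :=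
    ⟨(hu p hp1 hp N).1.sub hGm, (hN N le_rfl).trans_lt ENNReal.one_lt_top⟩
  simpa using (hu p hp1 hp N).sub hdiff

/-- A diagonal argument: countably many bounded real sequences converge along a common
subsequence. -/
lemma exists_strictMono_forall_tendsto {ι : Type*} [Countable ι] {u : ℕ → ι → ℝ} {b : ι → ℝ}
    (h : ∀ n i, |u n i| ≤ b i) :
    ∃ φ : ℕ → ℕ, StrictMono φ ∧ ∃ l : ι → ℝ, ∀ i, Tendsto (fun n => u (φ n) i) atTop (𝓝 (l i)) := by
  obtain ⟨l, -, φ, hφ, hl⟩ := (isCompact_univ_pi fun i =>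
    isCompact_Icc (a := -b i) (b := b i)).tendsto_subseq (x := u) fun n i _ => abs_le.1 (h n i)
  exact ⟨φ, hφ, l, fun i => tendsto_pi_nhds.1 hl i⟩

end KorevaarSchoen

open KorevaarSchoen in
theorem theorem4p5 {X : Type*} [MetricSpace X] [CompactSpace X] [MeasurableSpace X]
    [BorelSpace X] (μ : Measure X) (hVD : KorevaarSchoen.VolumeDoubling μ)
    (d_w : ℝ) (hd_w : 2 < d_w) (hP : KorevaarSchoen.Poincare μ d_w)
    (Q : ℝ) (hQ : KorevaarSchoen.VolumeGrowth μ Q) (hQ_pos : 0 < Q) (hQ_le : Q ≤ d_w)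
    (f : ℕ → X → ℝ) (hf : ∀ n, KorevaarSchoen.MemKS μ d_w (f n))
    (hbdd : (⨆ n, (eLpNorm (f n) 2 μ + KorevaarSchoen.lowerEnergy μ d_w Set.univ (f n))) < ∞) :
    ∃ φ : ℕ → ℕ, StrictMono φ ∧ ∃ g : X → ℝ, ∀ α : ℝ≥0∞, 1 ≤ α → α ≠ ∞ →
      MemLp g α μ ∧ (∀ k, MemLp (f (φ k)) α μ) ∧
        Tendsto (fun k => eLpNorm (f (φ k) - g) α μ) atTop (𝓝 0) := by
  have hfin : IsFiniteMeasure μ := ⟨hVD.measure_univ_lt_top⟩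
  set M : ℝ≥0∞ := ⨆ n, (eLpNorm (f n) 2 μ + lowerEnergy μ d_w Set.univ (f n))
  have hM : M ≠ ∞ := hbdd.ne
  have hnorm : ∀ n, eLpNorm (f n) 2 μ ≤ M := fun n =>
    le_self_add.trans (le_iSup (fun n => eLpNorm (f n) 2 μ + lowerEnergy μ d_w Set.univ (f n)) n)
  have henergy : ∀ n, lowerEnergy μ d_w Set.univ (f n) ≤ M := fun n =>
    le_add_self.trans (le_iSup (fun n => eLpNorm (f n) 2 μ + lowerEnergy μ d_w Set.univ (f n)) n)
  choose σ hσ using fun k : ℕ => exists_isNetProjection (X := X) (r := (1 / 2) ^ k) (by positivity)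
  have happrox := fun (p : ℝ≥0∞) (hp1 : 1 ≤ p) (hp : p ≠ ∞) =>
    exists_eLpNorm_sub_ballAverages_le hVD hP hQ hQ_pos hQ_le hσ hM hp1 hp
  have hmem : ∀ p : ℝ≥0∞, 1 ≤ p → p ≠ ∞ → ∀ n, MemLp (f n) p μ := by
    intro p hp1 hp n
    obtain ⟨ε, hε, hfε⟩ := happrox p hp1 hp
    obtain ⟨k, hk⟩ := (hε.eventually_lt_const one_pos).exists
    have hT : MemLp (ballAverages μ (σ k) ((1 / 2) ^ k) (f n)) p μ :=
      SimpleFunc.memLp_of_isFiniteMeasure _ p μ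
    have hdiff : MemLp (f n - ⇑(ballAverages μ (σ k) ((1 / 2) ^ k) (f n))) p μ :=
      ⟨(hf n).1.1.sub hT.1, (hfε _ (hf n) (henergy n) k).trans_lt (hk.trans ENNReal.one_lt_top)⟩
    simpa using hdiff.add hT
  -- All the means entering the step functions, over countably many balls, converge along one
  -- subsequence.
  obtain ⟨φ, hφ, l, hl⟩ := exists_strictMono_forall_tendsto
    (ι := Σ k : ℕ, {c : X // c ∈ (σ k).range})
    (u := fun n i => ⨍ z in ball i.2.1 ((1 / 2) ^ i.1), f n z ∂μ)
    (b := fun i => √(M ^ 2 / μ (ball i.2.1 ((1 / 2) ^ i.1))).toReal) (by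
      rintro n ⟨k, c, hc⟩
      have h0 := (hVD.measure_ball_pos c (r := (1 / 2) ^ k) (by positivity)).ne'
      have ht := (hVD.measure_ball_lt_top c (r := (1 / 2) ^ k) (by positivity)).ne
      have h1 := enorm_setAverage_sub_sq_mul_le (hf n).1 h0 ht 0
      simp only [sub_zero] at h1
      have h2 := h1.trans ((setLIntegral_le_lintegral _ _).trans
        (eLpNorm_two_le_iff_lintegral_enorm_sq_le.1 (hnorm n)))
      rw [← ENNReal.le_div_iff_mul_le (Or.inl h0) (Or.inl ht), enorm_sq_eq_ofReal,
        ENNReal.ofReal_le_iff_le_toReal (ENNReal.div_ne_top (by finiteness) h0)] at h2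
      exact Real.le_sqrt_of_sq_le h2)
  obtain ⟨g, hg⟩ := exists_common_tendsto_eLpNorm (μ := μ) (u := fun n => f (φ n))
    (fun p hp1 hp n => hmem p hp1 hp (φ n)) (by
      intro p hp1 hp ε hε
      obtain ⟨δ, hδ, hfδ⟩ := happrox p hp1 hp
      obtain ⟨k, hk⟩ := (hδ.eventually_lt_const (ENNReal.half_pos hε.ne')).exists
      set G : X → ℝ := fun x => l ⟨k, σ k x, SimpleFunc.mem_range_self _ x⟩
      have hptw : ∀ x, Tendsto (fun n => ballAverages μ (σ k) ((1 / 2) ^ k) (f (φ n)) x) atTop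
          (𝓝 (G x)) := fun x => hl ⟨k, σ k x, SimpleFunc.mem_range_self _ x⟩
      have hT : ∀ n, AEStronglyMeasurable (ballAverages μ (σ k) ((1 / 2) ^ k) (f (φ n))) μ :=
        fun n => (SimpleFunc.stronglyMeasurable _).aestronglyMeasurable
      have hG : AEStronglyMeasurable G μ :=
        aestronglyMeasurable_of_tendsto_ae atTop hT (ae_of_all _ hptw)
      obtain ⟨η, hη, hηε⟩ := ENNReal.exists_nnreal_pos_mul_lt
        (ENNReal.rpow_ne_top_of_nonneg (inv_nonneg.2 p.toReal_nonneg) (measure_ne_top μ Set.univ))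
        (ENNReal.half_pos hε.ne').ne'
      -- The step functions share one finite partition, so they converge uniformly.
      have hunif : ∀ᶠ n in atTop, ∀ i : {c : X // c ∈ (σ k).range},
          ‖(⨍ z in ball i.1 ((1 / 2) ^ k), f (φ n) z ∂μ) - l ⟨k, i⟩‖ ≤ η :=
        eventually_all.2 fun i =>
          (tendsto_iff_norm_sub_tendsto_zero.1 (hl ⟨k, i⟩)).eventually_le_const hη
      refine ⟨G, hG, hunif.mono fun n hn => ?_⟩
      have hTG : eLpNorm (⇑(ballAverages μ (σ k) ((1 / 2) ^ k) (f (φ n))) - G) p μ ≤ ε / 2 := by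
        refine (eLpNorm_le_of_ae_bound (C := η) (ae_of_all _ fun x =>
          hn ⟨σ k x, SimpleFunc.mem_range_self _ x⟩)).trans ?_
        rw [ENNReal.ofReal_coe_nnreal, mul_comm]
        exact hηε.le
      rw [← sub_add_sub_cancel (f (φ n)) (ballAverages μ (σ k) ((1 / 2) ^ k) (f (φ n))) G]
      refine (eLpNorm_add_le ((hf (φ n)).1.1.sub (hT n)) ((hT n).sub hG) hp1).trans ?_
      refine (add_le_add ((hfδ _ (hf (φ n)) (henergy _) k).trans hk.le) hTG).trans_eq ?_
      exact ENNReal.add_halves ε)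
  exact ⟨φ, hφ, g, fun α h1 h2 => ⟨(hg α h1 h2).1, fun k => hmem α h1 h2 (φ k), (hg α h1 h2).2⟩⟩
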